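/- Let $p$ be a prime, $e\ge 1$ and $q=p^e$. All rings are commutative, Noetherian and $F$-finite of characteristic $p$ (so nonzero). A *Cartier pair* $(R,\phi)$ is such a ring with an additive map $\phi\colon R\to R$ satisfying $\phi(r^{q}x)=r\,\phi(x)$, i.e. an $R$-linear map $F^e_*R\to R$. An ideal $\mathfrak a$ is a *$\phi$-ideal* if $\phi(\mathfrak a)\subseteq\mathfrak a$; a prime $\phi$-ideal $\mathfrak p$ is a *Cartier prime*, and then $\phi$ induces $\bar\phi_{\mathfrak p}\colon F^e_*\kappa(\mathfrak p)\to\kappa(\mathfrak p)$. A Cartier prime with $\bar\phi_{\mathfrak p}\ne0$ is a *center of $F$-purity*. The pair is *$F$-pure* if for every prime $\mathfrak p$ the Cartier core $\bigcap_{n\ge1}\{r:\phi^n(rR)\subseteq\mathfrak p\}$ is not $R$ (equivalently, $\phi$ is surjective). The *Cartier–Zariski topology* on $\operatorname{Spec}R$ has as closed sets the $V(\mathfrak a)$ with $\mathfrak a$ a $\phi$-ideal. For a center of $F$-purity $\mathfrak p$, $\tau_{\mathfrak p}(R,\phi)$ denotes the smallest $\phi$-ideal not contained in $\mathfrak p$.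 Let $\theta\colon R\to S$ be a finite ring homomorphism with $\ker\theta$ contained in the nilradical, and $\mathfrak T\in\operatorname{Hom}_R(S,R)$. For an ideal $\mathfrak a$ of $R$ put $\mathfrak a^{\mathfrak T}=\{s\in S:\mathfrak T(sS)\subseteq\mathfrak a\}$. Then $\theta$ is *tamely $\mathfrak T$-ramified over* a prime $\mathfrak p$ of $R$ if $\mathfrak p^{\mathfrak T}=\sqrt{\mathfrak pS}$. A *transposition of Cartier pairs* $(\theta,\mathfrak T)\colon(R,\phi)\to(S,\phi^{\mathfrak T})$ consists of such $\theta$ and $\mathfrak T$, with $\mathfrak T(S)$ not contained in the set of zero-divisors of $R$, and Cartier pairs with $\mathfrak T\circ\phi^{\mathfrak T}=\phi\circ\mathfrak T$. It is *fibered* if: 1. $\mathfrak q\mapsto\theta^{-1}(\mathfrak q)$ is continuous $\operatorname{Spec}S\to\operatorname{Spec}R$ for the Cartier–Zariski topologies (this implies that $\phi^{\mathfrak T}$ induces a map $\bar\phi^{\mathfrak T}_{\mathfrak p}$ on the reduced fiber $(S\otimes_R\kappa(\mathfrak p))_{\mathrm{red}}$ for each Cartier prime $\mathfrak p$ of $(R,\phi)$);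 2. $\mathfrak p^{\mathfrak T}$ is radical for every Cartier prime $\mathfrak p$ of $(R,\phi)$; 3. for every Cartier prime $\mathfrak p$ of $(R,\phi)$, if $\bar\phi_{\mathfrak p}\neq0$ then $\bar\phi^{\mathfrak T}_{\mathfrak p}$ is $F$-pure; 4. for every Cartier prime $\mathfrak p$ of $(R,\phi)$, if $\bar\phi_{\mathfrak p}=0$ then $\bar\phi^{\mathfrak T}_{\mathfrak p}=0$. **Theorem.** Let $(\theta,\mathfrak T)\colon(R,\phi)\to(S,\phi^{\mathfrak T})$ be a transposition of Cartier pairs. Consider: (a) $\theta$ is tamely $\mathfrak T$-ramified over every Cartier prime of $(R,\phi)$; (b) $(\theta,\mathfrak T)$ is fibered and $\mathfrak T(\tau_{\mathfrak q}(S,\phi^{\mathfrak T}))=\tau_{\mathfrak p}(R,\phi)$ for every center of $F$-purity $\mathfrak p$ of $(R,\phi)$ and every prime $\mathfrak q$ of $S$ lying over $\mathfrak p$; (c) $\theta$ is tamely $\mathfrak T$-ramified over every center of $F$-purity of $(R,\phi)$. Then (a) $\Rightarrow$ (b). If, for every center of $F$-purity $\mathfrak p$ of $(R,\phi)$, all minimal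 primes of $\mathfrak pS$ lie over $\mathfrak p$ (e.g. if $\theta$ satisfies going-down), then (b) $\Rightarrow$ (c). If $(R,\phi)$ is $F$-pure, then (a) $\Leftrightarrow$ (c), and under the same condition on minimal primes (a), (b), (c) are all equivalent. -/

import Mathlib

namespace TameCartier

open PrimeSpectrum

universe u v

/-! ### Ideals along additive maps, non-degeneracy, tame ramification -/

/-- For an additive map `f : B → A` of commutative rings and an ideal `a` of `A`, the ideal
`{b | f (b B) ⊆ a}` of `B`. -/
def transposeIdeal {A : Type u} {B : Type v} [CommRing A] [CommRing B] (f : B →+ A)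
    (a : Ideal A) : Ideal B where
  carrier := {b | ∀ c, f (b * c) ∈ a}
  add_mem' := fun hx hy c => by
    rw [add_mul, map_add]
    exact a.add_mem (hx c) (hy c)
  zero_mem' := fun c => by
    rw [zero_mul, map_zero]
    exact a.zero_mem
  smul_mem' := fun r x hx c => by
    have h := hx (r * c)
    rwa [← mul_assoc, mul_comm x r] at h

/-- The image ideal `T(b)` of an ideal `b` of `S` under an `R`-linear map `T : S → R`. -/
def imageIdeal {R : Type u} {S : Type v} [CommRing R] [CommRing S] [Algebra R S]
    (T : S →ₗ[R] R) (b : Ideal S) : Ideal R :=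
  Submodule.map T (b.restrictScalars R)

/-- The zero-divisors modulo `a`: the union of the associated primes of `A ⧸ a`. -/
def zeroDivisorsMod {A : Type u} [CommRing A] (a : Ideal A) : Set A :=
  ⋃ P ∈ associatedPrimes A (A ⧸ a), (P : Set A)

/-- `T` is non-degenerate: its image is not contained in the set of zero-divisors of `R`. -/
def IsNonDegenerate {R : Type u} {S : Type v} [CommRing R] [CommRing S] [Algebra R S]
    (T : S →ₗ[R] R) : Prop :=
  ¬ Set.range T ⊆ zeroDivisorsMod (⊥ : Ideal R)

/-- `S/R` is tamely `T`-ramified over the prime `P`: the transpose ideal of `P` along `T` is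
the radical of `P S`. -/
def IsTamelyRamified {R : Type u} {S : Type v} [CommRing R] [CommRing S] [Algebra R S]
    (T : S →ₗ[R] R) (P : PrimeSpectrum R) : Prop :=
  transposeIdeal T.toAddMonoidHom P.asIdeal = (P.asIdeal.map (algebraMap R S)).radical

/-! ### Cartier pairs -/

/-- An `A`-linear map `F^e_* A → A`, i.e. an additive map `φ : A → A` with
`φ (r ^ (p ^ e) * x) = r * φ x`. A Cartier pair is a ring `A` together with such a map. -/
structure CartierMap (p e : ℕ) (A : Type u) [CommRing A] extends A →+ A where
  map_pow_mul' : ∀ r x : A, toFun (r ^ (p ^ e) * x) = r * toFun x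

namespace CartierMap

variable {p e : ℕ} {A : Type u} [CommRing A]

instance : FunLike (CartierMap p e A) A A where
  coe φ := φ.toFun
  coe_injective := by
    rintro ⟨f, hf⟩ ⟨g, hg⟩ h
    congr
    exact DFunLike.coe_injective h

instance : Zero (CartierMap p e A) where
  zero := ⟨0, fun r x => by simp⟩

/-- `a` is a `φ`-ideal: `φ (F^e_* a) ⊆ a`. -/
def IsCompatible (φ : CartierMap p e A) (a : Ideal A) : Prop :=
  ∀ x ∈ a, φ x ∈ a

/-- The pairs `(A, φ)` and `(B, ψ)` are compatible along `f : A → B`, i.e. `ψ ∘ f = f ∘ φ`.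
When every element of `B` is of the form `f x / f w`, the map `ψ` is the unique one induced by
`φ` on `B`. -/
def Induces {B : Type v} [CommRing B] (φ : CartierMap p e A) (f : A →+* B)
    (ψ : CartierMap p e B) : Prop :=
  ∀ x, ψ (f x) = f (φ x)

/-- The Cartier spectrum: the primes that are `φ`-ideals (Cartier primes). -/
def CSpec (φ : CartierMap p e A) : Set (PrimeSpectrum A) :=
  {P | φ.IsCompatible P.asIdeal}

/-- The Schwede spectrum, i.e. the set of centers of `F`-purity: the Cartier primes `P` such
that the map induced by `φ` on the residue field of `P` is nonzero. -/
def Schpec (φ : CartierMap p e A) : Set (PrimeSpectrum A) :=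
  {P | P ∈ φ.CSpec ∧ ∃ φbar : CartierMap p e P.asIdeal.ResidueField,
    φ.Induces (algebraMap A P.asIdeal.ResidueField) φbar ∧ φbar ≠ 0}

/-- The iterate `φ^n = φ ∘ ⋯ ∘ φ`, as an additive map. -/
def iter (φ : CartierMap p e A) : ℕ → (A →+ A)
  | 0 => AddMonoidHom.id A
  | n + 1 => φ.toAddMonoidHom.comp (φ.iter n)

/-- The Cartier core `⋂_{n ≥ 1} {x | φ^n (x A) ⊆ a}` of an ideal `a`. -/
def cartierCore (φ : CartierMap p e A) (a : Ideal A) : Ideal A :=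
  ⨅ (n : ℕ) (_ : 1 ≤ n), transposeIdeal (φ.iter n) a

/-- The `F`-pure locus of `(A, φ)`: the primes whose Cartier core is a proper ideal. -/
def fPureLocus (φ : CartierMap p e A) : Set (PrimeSpectrum A) :=
  {P | φ.cartierCore P.asIdeal ≠ ⊤}

/-- `(A, φ)` is `F`-pure. -/
def IsFPure (φ : CartierMap p e A) : Prop :=
  φ.fPureLocus = Set.univ

/-- The test ideal along `a`: the smallest `φ`-ideal not contained in the set of zero-divisors
modulo `a`, given as the intersection of all of them. -/
def testIdeal (φ : CartierMap p e A) (a : Ideal A) : Ideal A :=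
  sInf {b | φ.IsCompatible b ∧ ¬ (b : Set A) ⊆ zeroDivisorsMod a}

theorem IsCompatible.iSup {ι : Sort*} (φ : CartierMap p e A) (a : ι → Ideal A)
    (h : ∀ i, φ.IsCompatible (a i)) : φ.IsCompatible (⨆ i, a i) := by
  intro x hx
  induction hx using Submodule.iSup_induction' with
  | mem i x hx => exact (le_iSup a i) (h i x hx)
  | zero =>
    have h0 : φ 0 = 0 := φ.toAddMonoidHom.map_zero
    rw [h0]
    exact zero_mem _
  | add x y _ _ hx hy =>
    have h1 : φ (x + y) = φ x + φ y := φ.toAddMonoidHom.map_add x y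
    rw [h1]
    exact add_mem hx hy

/-- The Cartier–Zariski topology on `Spec A`: the closed sets are the `V(a)` with `a` a
`φ`-ideal. -/
@[reducible] def czTopology (φ : CartierMap p e A) : TopologicalSpace (PrimeSpectrum A) :=
  TopologicalSpace.ofClosed
    {Z | ∃ a : Ideal A, φ.IsCompatible a ∧ Z = zeroLocus (a : Set A)}
    ⟨⊤, fun _ _ => trivial, by simp⟩
    (by
      intro C hC
      choose a ha hZ using fun Z : C => hC Z.2
      refine ⟨⨆ Z, a Z, IsCompatible.iSup φ _ ha, ?_⟩
      rw [zeroLocus_iSup, Set.sInter_eq_iInter]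
      exact Set.iInter_congr hZ)
    (by
      rintro _ ⟨a, ha, rfl⟩ _ ⟨b, hb, rfl⟩
      exact ⟨a ⊓ b, fun x hx => ⟨ha x hx.1, hb x hx.2⟩, (zeroLocus_inf a b).symm⟩)

end CartierMap

/-! ### Transpositions of Cartier pairs -/

section Transposition

variable {p e : ℕ} {R : Type u} {S : Type v} [CommRing R] [CommRing S] [Algebra R S]

/-- For the structure map `θ : R → S` and `T : S → R`, the data `(θ, T) : (R, φ) → (S, ψ)` is a
transposition of Cartier pairs: `θ` is finite with kernel contained in the nilradical, `T` is
non-degenerate and `T ∘ ψ = φ ∘ F^e_* T`. -/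
structure IsTransposition (T : S →ₗ[R] R) (φ : CartierMap p e R) (ψ : CartierMap p e S) :
    Prop where
  finite : Module.Finite R S
  ker_le : RingHom.ker (algebraMap R S) ≤ nilradical R
  nonDegenerate : IsNonDegenerate T
  comm : ∀ s, T (ψ s) = φ (T s)

/-- The reduced fiber `(S ⊗ κ(P))_red` over `P`. -/
abbrev ReducedFiber (S : Type v) [CommRing S] [Algebra R S] (P : PrimeSpectrum R) :=
  P.asIdeal.Fiber S ⧸ nilradical (P.asIdeal.Fiber S)

/-- The canonical ring homomorphism from `S` to the reduced fiber over `P`. -/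
noncomputable def toReducedFiber (S : Type v) [CommRing S] [Algebra R S]
    (P : PrimeSpectrum R) : S →+* ReducedFiber S P :=
  (Ideal.Quotient.mk (nilradical (P.asIdeal.Fiber S))).comp
    (Algebra.TensorProduct.includeRight (R := R) (A := P.asIdeal.ResidueField)
      (B := S)).toRingHom

/-- The transposition is quasi-fibered: `Spec S → Spec R` is continuous for the Cartier–Zariski
topologies; the transpose along `T` of every Cartier prime `P` is radical; and, for the maps
induced by `φ` on the residue field of `P` and by `ψ` on the reduced fiber over `P`, if the
first is nonzero then the second is `F`-pure. -/
structure IsQuasiFibered (T : S →ₗ[R] R) (φ : CartierMap p e R) (ψ : CartierMap p e S) :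
    Prop where
  continuous : @Continuous _ _ ψ.czTopology φ.czTopology (PrimeSpectrum.comap (algebraMap R S))
  isRadical : ∀ P ∈ φ.CSpec, (transposeIdeal T.toAddMonoidHom P.asIdeal).IsRadical
  fiber : ∀ P ∈ φ.CSpec, ∃ (φbar : CartierMap p e P.asIdeal.ResidueField)
    (ψbar : CartierMap p e (ReducedFiber S P)),
    φ.Induces (algebraMap R P.asIdeal.ResidueField) φbar ∧
    ψ.Induces (toReducedFiber S P) ψbar ∧ (φbar ≠ 0 → ψbar.IsFPure)

/-- The transposition is fibered: it is quasi-fibered and, for every Cartier prime `P` such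
that the map induced on the residue field of `P` is zero, so is the map induced on the reduced
fiber over `P`. -/
structure IsFibered (T : S →ₗ[R] R) (φ : CartierMap p e R) (ψ : CartierMap p e S) : Prop
    extends IsQuasiFibered T φ ψ where
  fiber_zero : ∀ P ∈ φ.CSpec, ∃ (φbar : CartierMap p e P.asIdeal.ResidueField)
    (ψbar : CartierMap p e (ReducedFiber S P)),
    φ.Induces (algebraMap R P.asIdeal.ResidueField) φbar ∧
    ψ.Induces (toReducedFiber S P) ψbar ∧ (φbar = 0 → ψbar = 0)

/-- `θ` is tamely `T`-ramified over every Cartier prime. -/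
def TameOverCSpec (T : S →ₗ[R] R) (φ : CartierMap p e R) : Prop :=
  ∀ P ∈ φ.CSpec, IsTamelyRamified T P

/-- `θ` is tamely `T`-ramified over every center of `F`-purity. -/
def TameOverSchpec (T : S →ₗ[R] R) (φ : CartierMap p e R) : Prop :=
  ∀ P ∈ φ.Schpec, IsTamelyRamified T P

/-- The transposition is fibered and, for every center of `F`-purity `P` and every prime `Q` of
`S` over `P`, the image under `T` of the test ideal along `Q` is the test ideal along `P`. -/
def FiberedWithTestIdeals (T : S →ₗ[R] R) (φ : CartierMap p e R) (ψ : CartierMap p e S) :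
    Prop :=
  IsFibered T φ ψ ∧ ∀ P ∈ φ.Schpec, ∀ Q : PrimeSpectrum S,
    PrimeSpectrum.comap (algebraMap R S) Q = P →
      imageIdeal T (ψ.testIdeal Q.asIdeal) = φ.testIdeal P.asIdeal

/-- Over every center of `F`-purity `P`, all minimal primes of `P S` lie over `P`, so that the
fiber over `P` is the set of minimal primes of `P S`. -/
def MinimalPrimesLieOver (S : Type v) [CommRing S] [Algebra R S] (φ : CartierMap p e R) : Prop :=
  ∀ P ∈ φ.Schpec, ∀ Q ∈ (P.asIdeal.map (algebraMap R S)).minimalPrimes,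
    Q.comap (algebraMap R S) = P.asIdeal

end Transposition

end TameCartier

namespace TameCartier

open PrimeSpectrum

universe u v

namespace CartierMap

variable {p e : ℕ} {A : Type u} [CommRing A]

/-! Write q = p^e and P^T for the transpose ideal. Since T ∘ ψ = φ ∘ T, both b ↦ T(b) and a ↦ a^T
preserve compatible ideals, and they are adjoint: T(b) ⊆ a iff b ⊆ a^T (`imageIdeal_le_iff`). If P
is tame, every Q over P contains P^T and, by incomparability, is minimal over it. Minimal primes of
compatible ideals are compatible, so Q is a Cartier prime; it is a center if P is
(`mem_schpec_of_isTamelyRamified`). This makes the transposition fibered. The adjunction then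
compares the test ideals: τ_Q lies in a^T for every competitor a for τ_P, and T(τ_Q) ⊆ P would force
τ_Q ⊆ P^T ⊆ Q. Conversely, if P^T ⊄ Q then τ_Q ⊆ P^T, so T(τ_Q) ⊆ P. In the F-pure case every
Cartier prime is a center.

Both contradictions need the intersection defining a test ideal along a center not to lie in that
center (`not_testIdeal_le`). This is the hard input. It rests on the finiteness of the set of
centers (`finite_schpec`), which comes from duality over the residue field and the determinant
trick. -/

instance : AddMonoidHomClass (CartierMap p e A) A A where
  map_add φ := φ.toAddMonoidHom.map_add
  map_zero φ := φ.toAddMonoidHom.map_zero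

theorem map_pow_mul (φ : CartierMap p e A) (r x : A) : φ (r ^ (p ^ e) * x) = r * φ x :=
  φ.map_pow_mul' r x

theorem zero_apply (x : A) : (0 : CartierMap p e A) x = 0 := rfl

/-! ### Compatible ideals -/

theorem IsCompatible.sInf {φ : CartierMap p e A} {s : Set (Ideal A)}
    (h : ∀ a ∈ s, φ.IsCompatible a) : φ.IsCompatible (sInf s) := fun x hx => by
  rw [Ideal.mem_sInf] at hx ⊢
  exact fun {a} ha => h a ha x (hx ha)

/-- If x t ∈ a, then t φ(x) = φ(t^q x), and t^q x is a multiple of x t. -/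
theorem IsCompatible.colon (hq : p ^ e ≠ 0) {φ : CartierMap p e A} {a : Ideal A}
    (h : φ.IsCompatible a) (t : A) : φ.IsCompatible (Submodule.colon a {t}) := fun x hx => by
  rw [Submodule.mem_colon_singleton, smul_eq_mul] at hx ⊢
  have ht : t ^ p ^ e * x = t ^ (p ^ e - 1) * (x * t) := by
    rw [← pow_sub_one_mul hq]
    ring
  rw [mul_comm, ← φ.map_pow_mul, ht]
  exact h _ (a.mul_mem_left _ hx)

theorem exists_eq_colon_of_mem_minimalPrimes [IsNoetherianRing A] {a Q : Ideal A}
    (hQ : Q ∈ a.minimalPrimes) : ∃ t, Q = Submodule.colon a {t} := by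
  refine Submodule.exists_eq_colon_of_mem_minimalPrimes (x := (1 : A)) ?_
  convert hQ
  ext x
  simp [Submodule.mem_colon_singleton]

theorem IsCompatible.of_mem_minimalPrimes [IsNoetherianRing A] (hq : p ^ e ≠ 0)
    {φ : CartierMap p e A} {a Q : Ideal A} (h : φ.IsCompatible a) (hQ : Q ∈ a.minimalPrimes) :
    φ.IsCompatible Q := by
  obtain ⟨t, rfl⟩ := exists_eq_colon_of_mem_minimalPrimes hQ
  exact h.colon hq t

/-! ### Induced maps -/

/-- Covers residue fields and reduced fibers at once. Denominators can be made q-th powers, which φ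
pulls out: a fraction f x / (f w)^q must go to f (φ x) / f w, and `hker` makes this well defined. -/
theorem exists_induces {B : Type v} [CommRing B] (hq : p ^ e ≠ 0) (φ : CartierMap p e A)
    (f : A →+* B) (hker : ∀ x, f x = 0 → f (φ x) = 0)
    (hf : ∀ b, ∃ x w, IsUnit (f w) ∧ b * f w = f x) :
    ∃ φbar : CartierMap p e B, φ.Induces f φbar := by
  have hf' : ∀ b, ∃ x w, IsUnit (f w) ∧ b * f w ^ p ^ e = f x := fun b => by
    obtain ⟨x, w, hw, hb⟩ := hf b
    refine ⟨x * w ^ (p ^ e - 1), w, hw, ?_⟩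
    rw [← mul_pow_sub_one hq, ← mul_assoc, hb, map_mul, map_pow]
  have key : ∀ b, ∃ y, ∀ x w, b * f w ^ p ^ e = f x → y * f w = f (φ x) := fun b => by
    obtain ⟨x, w, hw, hb⟩ := hf' b
    obtain ⟨v, hv⟩ := hw.exists_right_inv
    refine ⟨f (φ x) * v, fun x' w' hb' => ?_⟩
    have h0 : f (w' ^ p ^ e * x - w ^ p ^ e * x') = 0 := by
      simp only [map_sub, map_mul, map_pow, ← hb, ← hb']
      ring
    have h1 := hker _ h0
    rw [map_sub, φ.map_pow_mul, φ.map_pow_mul, map_sub, map_mul, map_mul] at h1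
    linear_combination v * h1 + f (φ x') * hv
  choose g hg using key
  have hg' : ∀ b y x w, IsUnit (f w) → b * f w ^ p ^ e = f x → y * f w = f (φ x) → g b = y :=
    fun b y x w hw hb hy => hw.mul_right_cancel ((hg b x w hb).trans hy.symm)
  have hadd : ∀ b b', g (b + b') = g b + g b' := fun b b' => by
    obtain ⟨x, w, hw, hb⟩ := hf' b
    obtain ⟨x', w', hw', hb'⟩ := hf' b'
    refine hg' _ _ (w' ^ p ^ e * x + w ^ p ^ e * x') (w * w') (by simpa using hw.mul hw') ?_ ?_
    · simp only [map_add, map_mul, map_pow, ← hb, ← hb']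
      ring
    · rw [map_add, φ.map_pow_mul, φ.map_pow_mul, map_add, map_mul, map_mul, map_mul,
        ← hg b x w hb, ← hg b' x' w' hb']
      ring
  have hmul : ∀ r b, g (r ^ p ^ e * b) = r * g b := fun r b => by
    obtain ⟨x, w, hw, hb⟩ := hf' b
    obtain ⟨x', w', hw', hb'⟩ := hf r
    refine hg' _ _ (x' ^ p ^ e * x) (w * w') (by simpa using hw.mul hw') ?_ ?_
    · simp only [map_mul, map_pow, ← hb, ← hb']
      ring
    · rw [φ.map_pow_mul, map_mul, map_mul, ← hb', ← hg b x w hb]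
      ring
  have hzero : g 0 = 0 := hg' 0 0 0 1 (by simp) (by simp) (by simp)
  exact ⟨⟨⟨⟨g, hzero⟩, hadd⟩, hmul⟩, fun x => hg' _ _ x 1 (by simp) (by simp) (by simp)⟩

theorem Induces.eq_zero {B : Type v} [CommRing B] (hq : p ^ e ≠ 0) {φ : CartierMap p e A}
    {f : A →+* B} {φbar : CartierMap p e B} (h : φ.Induces f φbar)
    (hf : ∀ b, ∃ x w, IsUnit (f w) ∧ b * f w = f x) (h0 : ∀ x, f (φ x) = 0) : φbar = 0 := by
  refine DFunLike.ext _ _ fun b => ?_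
  obtain ⟨x, w, hw, hb⟩ := hf b
  rw [zero_apply]
  refine hw.mul_left_cancel ?_
  rw [← φbar.map_pow_mul, mul_zero, ← mul_pow_sub_one hq, mul_assoc, mul_comm, mul_assoc,
    mul_comm _ (b * _), mul_comm, hb, mul_comm, ← map_pow, ← map_mul, h, h0]

theorem residueField_exists_mul_eq (P : Ideal A) [P.IsPrime] (b : P.ResidueField) :
    ∃ x w, IsUnit (algebraMap A P.ResidueField w) ∧
      b * algebraMap A P.ResidueField w = algebraMap A P.ResidueField x := by
  obtain ⟨y, rfl⟩ := IsLocalRing.residue_surjective b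
  obtain ⟨⟨x, w⟩, rfl⟩ := IsLocalization.mk'_surjective P.primeCompl y
  refine ⟨x, w, ?_, ?_⟩
  · rw [isUnit_iff_ne_zero, Ne, Ideal.algebraMap_residueField_eq_zero]
    exact w.2
  · rw [IsScalarTower.algebraMap_apply A (Localization.AtPrime P),
      IsScalarTower.algebraMap_apply A (Localization.AtPrime P) _ x,
      IsLocalRing.ResidueField.algebraMap_eq, ← map_mul, IsLocalization.mk'_spec]

theorem IsCompatible.exists_induces_residueField (hq : p ^ e ≠ 0) {φ : CartierMap p e A}
    {P : Ideal A} [P.IsPrime] (h : φ.IsCompatible P) :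
    ∃ φbar : CartierMap p e P.ResidueField, φ.Induces (algebraMap A P.ResidueField) φbar :=
  exists_induces hq φ _ (fun x hx => by
    rw [Ideal.algebraMap_residueField_eq_zero] at hx ⊢
    exact h x hx) (residueField_exists_mul_eq P)

theorem Induces.ne_zero_iff (hq : p ^ e ≠ 0) {φ : CartierMap p e A} {P : Ideal A} [P.IsPrime]
    {φbar : CartierMap p e P.ResidueField} (h : φ.Induces (algebraMap A P.ResidueField) φbar) :
    φbar ≠ 0 ↔ ∃ x, φ x ∉ P := by
  constructor
  · contrapose!
    intro h0
    exact h.eq_zero hq (residueField_exists_mul_eq P) fun x =>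
      Ideal.algebraMap_residueField_eq_zero.2 (h0 x)
  · rintro ⟨x, hx⟩ rfl
    exact hx (Ideal.algebraMap_residueField_eq_zero.1 ((h x).symm.trans (zero_apply _)))

theorem mem_schpec_iff (hq : p ^ e ≠ 0) {φ : CartierMap p e A} {P : PrimeSpectrum A} :
    P ∈ φ.Schpec ↔ P ∈ φ.CSpec ∧ ∃ x, φ x ∉ P.asIdeal := by
  constructor
  · rintro ⟨hP, φbar, h, h0⟩
    exact ⟨hP, (h.ne_zero_iff hq).1 h0⟩
  · rintro ⟨hP, hx⟩
    obtain ⟨φbar, h⟩ := IsCompatible.exists_induces_residueField hq hP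
    exact ⟨hP, φbar, h, (h.ne_zero_iff hq).2 hx⟩

/-! ### The trace-like form over a field -/

/-- The form (y, x) ↦ ψ(y x)^q on K over K^q is nondegenerate because ψ ≠ 0. As K is finite over
K^q, every basis x has a dual family y, and the formula is the expansion of d in that basis. -/
theorem exists_eq_sum_mul_apply_pow {K : Type u} [Field K] [Fact p.Prime] [CharP K p]
    [Module.Finite (iterateFrobenius K p e).fieldRange K] (ψ : CartierMap p e K) (hψ : ψ ≠ 0) :
    ∃ (n : ℕ) (x y : Fin n → K), ∀ d, d = ∑ i, x i * ψ (y i * d) ^ p ^ e := by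
  set k := (iterateFrobenius K p e).fieldRange
  let lin : K →ₗ[k] k :=
    { toFun x := ⟨ψ x ^ p ^ e, ψ x, rfl⟩
      map_add' x y := Subtype.ext <| by
        change ψ (x + y) ^ p ^ e = ψ x ^ p ^ e + ψ y ^ p ^ e
        rw [map_add, add_pow_char_pow]
      map_smul' := by
        rintro ⟨_, r, rfl⟩ x
        refine Subtype.ext ?_
        change ψ (r ^ p ^ e * x) ^ p ^ e = r ^ p ^ e * ψ x ^ p ^ e
        rw [ψ.map_pow_mul, mul_pow] }
  let B : K →ₗ[k] Module.Dual k K := (LinearMap.mul k K).compr₂ lin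
  have hB : ∀ y x, (B y x : K) = ψ (y * x) ^ p ^ e := fun _ _ => rfl
  have hinj : Function.Injective B := by
    rw [← LinearMap.ker_eq_bot, LinearMap.ker_eq_bot']
    intro y hy
    by_contra hy0
    refine hψ (DFunLike.ext _ _ fun x => ?_)
    have h := hB y (y⁻¹ * x)
    rw [hy, mul_inv_cancel_left₀ hy0] at h
    exact eq_zero_of_pow_eq_zero h.symm
  have hsurj : Function.Surjective B :=
    (LinearMap.injective_iff_surjective_of_finrank_eq_finrank
      Subspace.dual_finrank_eq.symm).1 hinj
  let b := Module.finBasis k K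
  choose y hy using fun i => hsurj (b.coord i)
  refine ⟨_, b, y, fun d => ?_⟩
  conv_lhs => rw [← b.sum_repr d]
  refine Finset.sum_congr rfl fun i _ => ?_
  rw [← hB, hy, mul_comm]
  rfl

end CartierMap

/-! ### Determinant trick, denominators and Frobenius-finiteness of residue fields -/

/-- Cayley–Hamilton for multiplication by c on I, which maps I into I · I: a monic polynomial with
lower coefficients in I kills I at c, so it vanishes at c because D is a domain. -/
theorem _root_.Ideal.exists_pow_mem_of_forall_mul_mem_sq {D : Type u} [CommRing D] [IsDomain D]
    {I : Ideal D} (hfg : I.FG) (hI : I ≠ ⊥) {c : D} (hc : ∀ d ∈ I, c * d ∈ I ^ 2) :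
    ∃ n, c ^ n ∈ I := by
  have : Module.Finite D I := Module.Finite.iff_fg.2 hfg
  obtain ⟨P, hP, -, hcoeff, haeval⟩ :=
    LinearMap.exists_monic_and_natDegree_eq_and_coeff_mem_pow_and_aeval_eq_zero D
      (algebraMap D (Module.End D I) c) I (by
        rintro _ ⟨d, rfl⟩
        rw [Module.algebraMap_end_apply, Submodule.mem_smul_top_iff, smul_eq_mul, ← pow_two]
        exact hc d d.2)
  obtain ⟨x, hx, hx0⟩ := Submodule.exists_mem_ne_zero_of_ne_bot hI
  have h0 : P.eval c = 0 := by
    have h := congrArg Subtype.val (LinearMap.congr_fun haeval ⟨x, hx⟩)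
    rw [Polynomial.aeval_algebraMap_apply, Module.algebraMap_end_apply] at h
    exact (mul_eq_zero.1 h).resolve_right hx0
  refine ⟨P.natDegree, ?_⟩
  rw [Polynomial.eval_eq_sum_range, Finset.sum_range_succ, hP.coeff_natDegree, one_mul] at h0
  rw [eq_neg_of_add_eq_zero_right h0]
  refine I.neg_mem (I.sum_mem fun k hk => I.mul_mem_right _ ?_)
  exact Ideal.pow_le_self (Nat.sub_ne_zero_of_lt (Finset.mem_range.1 hk)) (hcoeff k)

theorem exists_mul_eq_of_fintype {A : Type u} {K : Type v} [CommRing A] [Field K] (f : A →+* K)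
    (hf : ∀ b, ∃ x w, IsUnit (f w) ∧ b * f w = f x) {n : ℕ} (z : Fin n → K) :
    ∃ (w : A) (a : Fin n → A), f w ≠ 0 ∧ ∀ i, f (a i) = f w * z i := by
  classical
  choose x w hw h using fun i => hf (z i)
  refine ⟨∏ i, w i, fun i => (∏ j ∈ Finset.univ.erase i, w j) * x i, ?_, fun i => ?_⟩
  · rw [map_prod]
    exact Finset.prod_ne_zero_iff.2 fun i _ => (hw i).ne_zero
  · rw [← Finset.prod_erase_mul _ _ (Finset.mem_univ i), map_mul, map_mul, ← h]
    ring

/-- Phrased with additive subgroups so that, for g a Frobenius, no second module structure of a ring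
over itself is needed. -/
theorem _root_.RingHom.Finite.exists_finset_forall_mem {B : Type u} {C : Type v} [CommRing B]
    [CommRing C] {g : B →+* C} (hg : g.Finite) :
    ∃ s : Finset C, ∀ N : AddSubgroup C, (∀ x ∈ s, x ∈ N) → (∀ r, ∀ x ∈ N, g r * x ∈ N) →
      ∀ x, x ∈ N := by
  algebraize [g]
  obtain ⟨s, hs⟩ := (Module.Finite.fg_top : (⊤ : Submodule B C).FG)
  refine ⟨s, fun N hsN hN x => ?_⟩
  have hx : x ∈ Submodule.span B (s : Set C) := hs ▸ Submodule.mem_top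
  induction hx using Submodule.span_induction with
  | mem x hx => exact hsN x hx
  | zero => exact zero_mem _
  | add x y _ _ hx hy => exact add_mem hx hy
  | smul r x _ hx =>
    rw [Algebra.smul_def]
    exact hN r x hx

theorem finite_fieldRange_of_finite {p e : ℕ} [Fact p.Prime] {A : Type u} {K : Type v}
    [CommRing A] [CharP A p] [Field K] [CharP K p] (f : A →+* K)
    (hf : ∀ b, ∃ x w, IsUnit (f w) ∧ b * f w = f x) (hF : (iterateFrobenius A p e).Finite) :
    Module.Finite (iterateFrobenius K p e).fieldRange K := by
  obtain ⟨s, hs⟩ := hF.exists_finset_forall_mem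
  set k := (iterateFrobenius K p e).fieldRange
  have hpow : ∀ r : K, r ^ p ^ e ∈ k := fun r => ⟨r, rfl⟩
  have hspan : ∀ a : A, f a ∈ Submodule.span k (f '' (s : Set A)) := by
    refine hs ((Submodule.span k (f '' (s : Set A))).toAddSubgroup.comap f.toAddMonoidHom)
      (fun x hx => Submodule.subset_span ⟨x, hx, rfl⟩) fun r x hx => ?_
    have h : f (r ^ p ^ e * x) = (⟨f r ^ p ^ e, hpow _⟩ : k) • f x := by
      change f (r ^ p ^ e * x) = f r ^ p ^ e * f x
      rw [map_mul, map_pow]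
    change f (r ^ p ^ e * x) ∈ Submodule.span k (f '' (s : Set A))
    rw [h]
    exact Submodule.smul_mem _ _ hx
  classical
  refine ⟨⟨s.image f, ?_⟩⟩
  rw [Finset.coe_image, eq_top_iff]
  rintro b -
  obtain ⟨x, w, hw, hb⟩ := hf b
  have hq : p ^ e ≠ 0 := pow_ne_zero _ (Fact.out : p.Prime).ne_zero
  -- Enlarging the denominator to a q-th power turns its inverse into a scalar of K^q.
  have h : b = (⟨(f w)⁻¹ ^ p ^ e, hpow _⟩ : k) • f (w ^ (p ^ e - 1) * x) := by
    change b = (f w)⁻¹ ^ p ^ e * f (w ^ (p ^ e - 1) * x)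
    have h1 : f (w ^ (p ^ e - 1) * x) = f w ^ p ^ e * b := by
      rw [map_mul, map_pow, ← hb, ← pow_sub_one_mul hq (f w)]
      ring
    rw [h1, inv_pow, inv_mul_cancel_left₀ (pow_ne_zero _ hw.ne_zero)]
  rw [h]
  exact Submodule.smul_mem _ _ (hspan _)

/-! ### Cartier primes strictly above a center of F-purity -/

namespace CartierMap

variable {p e : ℕ} {A : Type u} [CommRing A]

/-- The dual-basis formula over κ(Q), with denominators cleared, writes c d modulo Q through q-th
powers of values of φ on multiples of d. For d ∈ I these values lie in I, and q ≥ 2. The element c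
does not depend on I. -/
theorem exists_mul_sub_mem_sq [Fact p.Prime] (he : 1 ≤ e) [CharP A p]
    (hF : (iterateFrobenius A p e).Finite) {φ : CartierMap p e A} {Q : Ideal A} [Q.IsPrime]
    (hQ : φ.IsCompatible Q) (hne : ∃ x, φ x ∉ Q) :
    ∃ c ∉ Q, ∀ I : Ideal A, φ.IsCompatible I → ∀ d ∈ I, ∃ z ∈ I ^ 2, c * d - z ∈ Q := by
  have hp : p ≠ 0 := (Fact.out : p.Prime).ne_zero
  have hq : p ^ e ≠ 0 := pow_ne_zero _ hp
  have hq2 : 2 ≤ p ^ e :=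
    (Fact.out : p.Prime).two_le.trans (Nat.le_self_pow (by omega) p)
  set K := Q.ResidueField
  set f := algebraMap A K
  have hf := residueField_exists_mul_eq Q
  have hK : CharP K p := by
    have h := CharP.ringChar_of_prime_eq_zero (R := K) (Fact.out : p.Prime)
      (by rw [← map_natCast f p, CharP.cast_eq_zero, map_zero])
    exact ringChar.of_eq h
  have := finite_fieldRange_of_finite f hf hF
  obtain ⟨ψ, hψ⟩ := IsCompatible.exists_induces_residueField hq hQ
  obtain ⟨n, x, y, hxy⟩ := exists_eq_sum_mul_apply_pow ψ ((hψ.ne_zero_iff hq).2 hne)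
  obtain ⟨w, a, hw, ha⟩ := exists_mul_eq_of_fintype f hf x
  obtain ⟨w', b, hw', hb⟩ := exists_mul_eq_of_fintype f hf y
  -- The common denominator w' of the y i sits inside ψ, so it is raised to the q-th power: ψ(w'^q y
  -- d) = w' ψ(y d).
  have hψ' : ∀ x, f (φ x) = ψ (f x) := fun x => (hψ x).symm
  have hz : ∀ d, f (w * w' ^ p ^ e * d) =
      f (∑ i, a i * φ (w' ^ (p ^ e - 1) * b i * d) ^ p ^ e) := fun d => by
    rw [map_mul, map_sum, hxy (f d), Finset.mul_sum]
    refine Finset.sum_congr rfl fun i _ => ?_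
    have h1 : f (w' ^ (p ^ e - 1) * b i * d) = f w' ^ p ^ e * (y i * f d) := by
      rw [map_mul, map_mul, hb, map_pow, ← pow_sub_one_mul hq (f w')]
      ring
    rw [map_mul f (a i), map_pow f (φ _), hψ', h1, ψ.map_pow_mul, ha, map_mul, map_pow]
    ring
  refine ⟨w * w' ^ p ^ e, ?_, fun I hI d hd =>
    ⟨∑ i, a i * φ (w' ^ (p ^ e - 1) * b i * d) ^ p ^ e, ?_, ?_⟩⟩
  · rw [← Ideal.algebraMap_residueField_eq_zero, map_mul, map_pow]
    exact mul_ne_zero hw (pow_ne_zero _ hw')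
  · refine Ideal.sum_mem _ fun i _ => Ideal.mul_mem_left _ _ (Ideal.pow_le_pow_right hq2 ?_)
    exact Ideal.pow_mem_pow (hI _ (I.mul_mem_left _ hd)) _
  · rw [← Ideal.algebraMap_residueField_eq_zero, map_sub, sub_eq_zero]
    exact hz d

/-- The determinant trick in the domain A/Q, applied to the nonzero image of P, puts a power of c in
P. -/
theorem exists_notMem_forall_lt_mem [Fact p.Prime] (he : 1 ≤ e) [CharP A p] [IsNoetherianRing A]
    (hF : (iterateFrobenius A p e).Finite) {φ : CartierMap p e A} {Q : Ideal A} [Q.IsPrime]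
    (hQ : φ.IsCompatible Q) (hne : ∃ x, φ x ∉ Q) :
    ∃ c ∉ Q, ∀ P : Ideal A, P.IsPrime → φ.IsCompatible P → Q < P → c ∈ P := by
  obtain ⟨c, hcQ, hc⟩ := exists_mul_sub_mem_sq he hF hQ hne
  refine ⟨c, hcQ, fun P hP hφP hlt => ?_⟩
  have hmk : ∀ x, Ideal.Quotient.mk Q x ∈ P.map (Ideal.Quotient.mk Q) ↔ x ∈ P := fun x => by
    rw [← Ideal.mem_comap, Ideal.comap_map_of_surjective _ Ideal.Quotient.mk_surjective,
      ← RingHom.ker_eq_comap_bot, Ideal.mk_ker, sup_eq_left.2 hlt.le]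
  obtain ⟨n, hn⟩ := Ideal.exists_pow_mem_of_forall_mul_mem_sq
    (I := P.map (Ideal.Quotient.mk Q)) (c := Ideal.Quotient.mk Q c) (IsNoetherian.noetherian _)
    (fun h => hlt.not_ge fun x hx => by
      rw [← hmk, h, Ideal.mem_bot, Ideal.Quotient.eq_zero_iff_mem] at hx
      exact hx)
    (fun d hd => by
      obtain ⟨d, rfl⟩ := Ideal.Quotient.mk_surjective d
      obtain ⟨z, hz, hcz⟩ := hc P hφP d ((hmk d).1 hd)
      rw [← map_mul, Ideal.Quotient.eq.2 hcz, ← Ideal.map_pow]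
      exact Ideal.mem_map_of_mem _ hz)
  rw [← map_pow, hmk] at hn
  exact hP.mem_of_pow_mem n hn

/-! ### Finiteness of the set of centers of `F`-purity -/

/-- Noetherian induction on a compatible ideal I, for the centers containing I. A nonprime I is
replaced by its finitely many minimal primes; a prime I containing the image of φ lies in no center.
-/
theorem finite_schpec [Fact p.Prime] (he : 1 ≤ e) [CharP A p] [IsNoetherianRing A]
    (hF : (iterateFrobenius A p e).Finite) (φ : CartierMap p e A) : φ.Schpec.Finite := by
  have hq : p ^ e ≠ 0 := pow_ne_zero _ (Fact.out : p.Prime).ne_zero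
  suffices H : ∀ I : Ideal A, φ.IsCompatible I →
      {P | P ∈ φ.Schpec ∧ I ≤ P.asIdeal}.Finite from
    (H ⊥ (fun x hx => by rw [Ideal.mem_bot.1 hx, map_zero]; exact zero_mem _)).subset
      fun P hP => ⟨hP, bot_le⟩
  intro I
  induction I using WellFoundedGT.induction with
  | ind I ih =>
  intro hI
  by_cases hprime : I.IsPrime
  · by_cases hne : ∃ x, φ x ∉ I
    · obtain ⟨c, hcI, hc⟩ := exists_notMem_forall_lt_mem he hF hI hne
      -- All centers above I other than I itself contain J, and J is strictly larger than I because
      -- it contains c.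
      let J := sInf {P : Ideal A | P.IsPrime ∧ φ.IsCompatible P ∧ I < P}
      have hIJ : I < J := by
        refine lt_of_le_of_ne (le_sInf fun P hP => hP.2.2.le) fun h => hcI ?_
        rw [h]
        exact Ideal.mem_sInf.2 fun {P} hP => hc P hP.1 hP.2.1 hP.2.2
      refine ((ih J hIJ (IsCompatible.sInf fun P hP => hP.2.1)).union
        (Set.finite_singleton ⟨I, hprime⟩)).subset fun P hP => ?_
      by_cases h : I = P.asIdeal
      · exact Or.inr (PrimeSpectrum.ext h.symm)
      · exact Or.inl ⟨hP.1, sInf_le ⟨P.2, hP.1.1, lt_of_le_of_ne hP.2 h⟩⟩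
    · refine Set.finite_empty.subset fun P hP => hne ?_
      obtain ⟨x, hx⟩ := ((mem_schpec_iff hq).1 hP.1).2
      exact ⟨x, fun h => hx (hP.2 h)⟩
  · refine ((Ideal.finite_minimalPrimes_of_isNoetherianRing A I).biUnion
      (t := fun Q => {P | P ∈ φ.Schpec ∧ Q ≤ P.asIdeal}) fun Q hQ => ?_).subset fun P hP => ?_
    · refine ih Q (lt_of_le_of_ne hQ.1.2 ?_) (hI.of_mem_minimalPrimes hq hQ)
      rintro rfl
      exact hprime hQ.1.1
    · obtain ⟨Q, hQ, hQP⟩ := Ideal.exists_minimalPrimes_le hP.2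
      exact Set.mem_biUnion hQ ⟨hP.1, hQP⟩

/-! ### Test ideals along primes -/

theorem _root_.TameCartier.zeroDivisorsMod_of_isPrime [IsNoetherianRing A] (Q : Ideal A)
    [hQ : Q.IsPrime] : zeroDivisorsMod Q = Q := by
  rw [zeroDivisorsMod, associatedPrimes.eq_singleton_of_isPrimary hQ.isPrimary, hQ.radical,
    Set.biUnion_singleton]

theorem testIdeal_le [IsNoetherianRing A] {φ : CartierMap p e A} {Q b : Ideal A} [Q.IsPrime]
    (hb : φ.IsCompatible b) (hbQ : ¬ b ≤ Q) : φ.testIdeal Q ≤ b :=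
  sInf_le ⟨hb, by rwa [zeroDivisorsMod_of_isPrime]⟩

theorem isCompatible_testIdeal (φ : CartierMap p e A) (a : Ideal A) :
    φ.IsCompatible (φ.testIdeal a) :=
  IsCompatible.sInf fun _ h => h.1

/-- Put g = φ(f) h. If g^n ∈ b and m q ≥ n, then g^m φ(f) = φ(g^(mq) f) ∈ b, so g^(m+1) ∈ b. With m
= ⌈n/2⌉ the exponent drops as long as n > 3. The bound 3 is uniform in b. -/
theorem pow_three_mem_of_pow_mem (hq2 : 2 ≤ p ^ e) {φ : CartierMap p e A} {b : Ideal A}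
    (hb : φ.IsCompatible b) {f h : A} (n : ℕ) (hn : (φ f * h) ^ n ∈ b) : (φ f * h) ^ 3 ∈ b := by
  induction n using Nat.strong_induction_on with
  | _ n ih =>
  by_cases h3 : n ≤ 3
  · exact b.pow_mem_of_pow_mem hn h3
  · set m := (n + 1) / 2
    refine ih (m + 1) (by omega) ?_
    have h1 : φ ((((φ f * h) ^ m) ^ p ^ e) * f) ∈ b := by
      refine hb _ (b.mul_mem_right _ ?_)
      rw [← pow_mul]
      refine b.pow_mem_of_pow_mem hn ?_
      calc n ≤ m * 2 := by omega
        _ ≤ m * p ^ e := Nat.mul_le_mul_left m hq2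
    rw [φ.map_pow_mul] at h1
    rw [pow_succ, ← mul_assoc]
    exact b.mul_mem_right _ h1

/-- Choose φ(f) ∉ Q, and h ∉ Q in every center not contained in Q, which is possible as these are
finitely many. A minimal prime of a competing ideal b either is such a center, hence contains h, or
contains the image of φ. So φ(f) h lies in the radical of every b, and its cube in every b. -/
theorem not_testIdeal_le [Fact p.Prime] (he : 1 ≤ e) [CharP A p] [IsNoetherianRing A]
    (hF : (iterateFrobenius A p e).Finite) {φ : CartierMap p e A} {Q : PrimeSpectrum A}
    (hQ : Q ∈ φ.Schpec) : ¬ φ.testIdeal Q.asIdeal ≤ Q.asIdeal := by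
  have hq : p ^ e ≠ 0 := pow_ne_zero _ (Fact.out : p.Prime).ne_zero
  have hq2 : 2 ≤ p ^ e :=
    (Fact.out : p.Prime).two_le.trans (Nat.le_self_pow (by omega) p)
  obtain ⟨f, hf⟩ := ((mem_schpec_iff hq).1 hQ).2
  have hfin : {P | P ∈ φ.Schpec ∧ ¬ P.asIdeal ≤ Q.asIdeal}.Finite :=
    (finite_schpec he hF φ).subset fun P hP => hP.1
  have hinf : ¬ hfin.toFinset.inf PrimeSpectrum.asIdeal ≤ Q.asIdeal := by
    rw [Q.2.inf_le']
    rintro ⟨P, hP, hPQ⟩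
    exact (hfin.mem_toFinset.1 hP).2 hPQ
  obtain ⟨h, hh, hhQ⟩ := SetLike.not_le_iff_exists.1 hinf
  intro hle
  have hc : (φ f * h) ^ 3 ∈ φ.testIdeal Q.asIdeal := by
    refine Ideal.mem_sInf.2 fun {b} hb => ?_
    rw [zeroDivisorsMod_of_isPrime] at hb
    have hrad : φ f * h ∈ b.radical := by
      rw [← Ideal.sInf_minimalPrimes]
      refine Ideal.mem_sInf.2 fun {P} hP => ?_
      by_cases hne : ∃ x, φ x ∉ P
      · refine P.mul_mem_left _ ?_
        have hP' : (⟨P, hP.1.1⟩ : PrimeSpectrum A) ∈ hfin.toFinset :=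
          hfin.mem_toFinset.2 ⟨(mem_schpec_iff hq).2 ⟨hb.1.of_mem_minimalPrimes hq hP, hne⟩,
            fun hPQ => hb.2 (hP.1.2.trans hPQ)⟩
        exact (Finset.inf_le hP' : _ ≤ P) hh
      · push Not at hne
        exact P.mul_mem_right _ (hne f)
    obtain ⟨n, hn⟩ := hrad
    exact pow_three_mem_of_pow_mem hq2 hb.1 n hn
  exact (Q.2.mem_or_mem (Q.2.mem_of_pow_mem 3 (hle hc))).elim hf hhQ

end CartierMap

section Transposition

variable {p e : ℕ} {R : Type u} {S : Type v} [CommRing R] [CommRing S] [Algebra R S]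

/-! ### Transpose ideals -/

theorem mem_transposeIdeal {T : S →ₗ[R] R} {a : Ideal R} {s : S} :
    s ∈ transposeIdeal T.toAddMonoidHom a ↔ ∀ c, T (s * c) ∈ a := Iff.rfl

theorem isCompatible_transposeIdeal {T : S →ₗ[R] R} {φ : CartierMap p e R} {ψ : CartierMap p e S}
    (h : ∀ s, T (ψ s) = φ (T s)) {a : Ideal R} (ha : φ.IsCompatible a) :
    ψ.IsCompatible (transposeIdeal T.toAddMonoidHom a) := fun s hs => by
  rw [mem_transposeIdeal] at hs ⊢
  intro c
  rw [mul_comm, ← ψ.map_pow_mul, h, mul_comm]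
  exact ha _ (hs _)

theorem map_le_transposeIdeal (T : S →ₗ[R] R) (a : Ideal R) :
    a.map (algebraMap R S) ≤ transposeIdeal T.toAddMonoidHom a := by
  rw [Ideal.map_le_iff_le_comap]
  intro r hr
  rw [Ideal.mem_comap, mem_transposeIdeal]
  intro c
  rw [← Algebra.smul_def, map_smul, smul_eq_mul]
  exact a.mul_mem_right _ hr

theorem imageIdeal_le_iff {T : S →ₗ[R] R} {a : Ideal R} {b : Ideal S} :
    imageIdeal T b ≤ a ↔ b ≤ transposeIdeal T.toAddMonoidHom a := by
  constructor
  · exact fun h s hs c => h ⟨s * c, b.mul_mem_right _ hs, rfl⟩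
  · rintro h _ ⟨s, hs, rfl⟩
    simpa using mem_transposeIdeal.1 (h hs) 1

theorem isCompatible_imageIdeal {T : S →ₗ[R] R} {φ : CartierMap p e R} {ψ : CartierMap p e S}
    (h : ∀ s, T (ψ s) = φ (T s)) {b : Ideal S} (hb : ψ.IsCompatible b) :
    φ.IsCompatible (imageIdeal T b) := by
  rintro _ ⟨s, hs, rfl⟩
  exact ⟨ψ s, hb s hs, h s⟩

/-- Incomparability: a smaller prime over J would contract to a prime strictly below P, yet it
contains P S. -/
theorem mem_minimalPrimes_of_comap_eq [Algebra.IsIntegral R S] {P : Ideal R} {J Q : Ideal S}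
    [hQ : Q.IsPrime] (hPJ : P.map (algebraMap R S) ≤ J) (hJQ : J ≤ Q)
    (hQP : Q.comap (algebraMap R S) = P) : Q ∈ J.minimalPrimes := by
  refine ⟨⟨hQ, hJQ⟩, fun Q' hQ' hle => ?_⟩
  have := hQ'.1
  by_contra hne
  have hlt := Ideal.IsIntegral.comap_lt_comap (R := R) (lt_of_le_not_ge hle hne)
  rw [hQP] at hlt
  exact hlt.not_ge (Ideal.map_le_iff_le_comap.1 (hPJ.trans hQ'.2))

theorem IsTamelyRamified.transposeIdeal_le {T : S →ₗ[R] R} {P : PrimeSpectrum R}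
    (h : IsTamelyRamified T P) {Q : PrimeSpectrum S} (hQ : comap (algebraMap R S) Q = P) :
    transposeIdeal T.toAddMonoidHom P.asIdeal ≤ Q.asIdeal := by
  rw [h, Q.2.radical_le_iff, Ideal.map_le_iff_le_comap, ← hQ]
  exact le_rfl

/-! ### The reduced fiber -/

/-- The nilradical is the intersection of the primes of the fiber ring, which correspond to the
primes of S over P. -/
theorem toReducedFiber_eq_zero_iff {P : PrimeSpectrum R} {s : S} :
    toReducedFiber S P s = 0 ↔
      ∀ Q : PrimeSpectrum S, comap (algebraMap R S) Q = P → s ∈ Q.asIdeal := by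
  have h : toReducedFiber S P s = 0 ↔
      (1 : P.asIdeal.ResidueField) ⊗ₜ[R] s ∈ nilradical (P.asIdeal.Fiber S) :=
    Ideal.Quotient.eq_zero_iff_mem
  rw [h, mem_nilradical, nilpotent_iff_mem_prime]
  constructor
  · intro h Q hQ
    have h1 := h _ (preimageEquivFiber R S P ⟨Q, hQ⟩).2
    have h2 := (preimageEquivFiber R S P).symm_apply_apply ⟨Q, hQ⟩
    have h3 : s ∈ ((preimageEquivFiber R S P).symm
      (preimageEquivFiber R S P ⟨Q, hQ⟩)).1.asIdeal := h1
    rwa [h2] at h3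
  · intro h J hJ
    exact h _ ((preimageEquivFiber R S P).symm ⟨J, hJ⟩).2

theorem toReducedFiber_algebraMap (P : PrimeSpectrum R) (r : R) :
    toReducedFiber S P (algebraMap R S r) =
      algebraMap P.asIdeal.ResidueField (ReducedFiber S P)
        (algebraMap R P.asIdeal.ResidueField r) := by
  change Ideal.Quotient.mk _ ((1 : P.asIdeal.ResidueField) ⊗ₜ[R] algebraMap R S r) =
    Ideal.Quotient.mk _ ((algebraMap R P.asIdeal.ResidueField r) ⊗ₜ[R] (1 : S))
  rw [Algebra.algebraMap_eq_smul_one, ← TensorProduct.smul_tmul, ← Algebra.algebraMap_eq_smul_one]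

theorem toReducedFiber_exists_mul_eq (P : PrimeSpectrum R) (b : ReducedFiber S P) :
    ∃ x w, IsUnit (toReducedFiber S P w) ∧ b * toReducedFiber S P w = toReducedFiber S P x := by
  obtain ⟨b, rfl⟩ := Ideal.Quotient.mk_surjective b
  obtain ⟨r, hr, s, hs⟩ := Ideal.Fiber.exists_smul_eq_one_tmul P.asIdeal b
  refine ⟨s, algebraMap R S r, ?_, ?_⟩
  · rw [toReducedFiber_algebraMap]
    refine IsUnit.map _ (isUnit_iff_ne_zero.2 ?_)
    rwa [Ne, Ideal.algebraMap_residueField_eq_zero]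
  · change _ = Ideal.Quotient.mk _ ((1 : P.asIdeal.ResidueField) ⊗ₜ[R] s)
    rw [← hs, toReducedFiber_algebraMap, Algebra.smul_def, map_mul]
    exact mul_comm _ _

theorem comap_toReducedFiber {P : PrimeSpectrum R} (q : PrimeSpectrum (ReducedFiber S P)) :
    comap (algebraMap R S) (comap (toReducedFiber S P) q) = P := by
  ext r
  change toReducedFiber S P (algebraMap R S r) ∈ q.asIdeal ↔ _
  rw [toReducedFiber_algebraMap, ← Ideal.mem_comap,
    (Ideal.eq_bot_of_prime (q.asIdeal.comap (algebraMap P.asIdeal.ResidueField _))),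
    Ideal.mem_bot, Ideal.algebraMap_residueField_eq_zero]

/-! ### Consequences of tame ramification -/

namespace IsTransposition

variable {T : S →ₗ[R] R} {φ : CartierMap p e R} {ψ : CartierMap p e S}

theorem isNoetherianRing [IsNoetherianRing R] (h : IsTransposition T φ ψ) : IsNoetherianRing S :=
  have := h.finite
  IsNoetherianRing.of_finite R S

theorem mem_cSpec_of_isTamelyRamified [IsNoetherianRing R] (hq : p ^ e ≠ 0)
    (h : IsTransposition T φ ψ) {P : PrimeSpectrum R} (hP : P ∈ φ.CSpec)
    (ht : IsTamelyRamified T P) {Q : PrimeSpectrum S} (hQ : comap (algebraMap R S) Q = P) :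
    Q ∈ ψ.CSpec := by
  have := h.finite
  have := h.isNoetherianRing
  exact (isCompatible_transposeIdeal h.comm hP).of_mem_minimalPrimes hq
    (mem_minimalPrimes_of_comap_eq (map_le_transposeIdeal T _) (ht.transposeIdeal_le hQ)
      (congrArg PrimeSpectrum.asIdeal hQ))

/-- Write Q = (J : t) with J = P^T radical. Then t^q ∉ J, so some a = T(t^q c) is not in P. If ψ
took values in Q only, applying T to t ψ(a^(q-1) x c) ∈ J would give a φ(x) ∈ P for all x. -/
theorem mem_schpec_of_isTamelyRamified [IsNoetherianRing R] (hq : p ^ e ≠ 0)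
    (h : IsTransposition T φ ψ) {P : PrimeSpectrum R} (hP : P ∈ φ.Schpec)
    (ht : IsTamelyRamified T P) {Q : PrimeSpectrum S} (hQ : comap (algebraMap R S) Q = P) :
    Q ∈ ψ.Schpec := by
  have := h.finite
  have := h.isNoetherianRing
  rw [CartierMap.mem_schpec_iff hq] at hP ⊢
  refine ⟨h.mem_cSpec_of_isTamelyRamified hq hP.1 ht hQ, ?_⟩
  by_contra! hψ
  set J := transposeIdeal T.toAddMonoidHom P.asIdeal
  have hrad : J.IsRadical := by
    rw [show J = _ from ht]
    exact Ideal.radical_isRadical _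
  obtain ⟨t, ht'⟩ := CartierMap.exists_eq_colon_of_mem_minimalPrimes
    (mem_minimalPrimes_of_comap_eq (map_le_transposeIdeal T _) (ht.transposeIdeal_le hQ)
      (congrArg PrimeSpectrum.asIdeal hQ))
  have htJ : t ^ p ^ e ∉ J := fun hmem => Q.2.ne_top <| by
    rw [ht', Submodule.colon_eq_top_iff_subset, Set.singleton_subset_iff]
    exact hrad ⟨_, hmem⟩
  obtain ⟨c, hc⟩ := not_forall.1 (mt mem_transposeIdeal.2 htJ)
  obtain ⟨x, hx⟩ := hP.2
  set a := T (t ^ p ^ e * c)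
  have h1 : t * ψ (algebraMap R S (a ^ (p ^ e - 1) * x) * c) ∈ J := by
    have := hψ (algebraMap R S (a ^ (p ^ e - 1) * x) * c)
    rw [ht', Submodule.mem_colon_singleton, smul_eq_mul] at this
    rwa [mul_comm]
  have h2 : T (t ^ p ^ e * (algebraMap R S (a ^ (p ^ e - 1) * x) * c)) = a ^ p ^ e * x := by
    rw [mul_left_comm, ← Algebra.smul_def, map_smul, smul_eq_mul, ← pow_sub_one_mul hq a]
    ring
  have h3 := mem_transposeIdeal.1 h1 1
  rw [mul_one, ← ψ.map_pow_mul, h.comm, h2, φ.map_pow_mul] at h3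
  exact (P.2.mem_or_mem h3).elim hc hx

end IsTransposition

theorem continuous_comap_of_tameOverCSpec [IsNoetherianRing R] (hq : p ^ e ≠ 0)
    {T : S →ₗ[R] R} {φ : CartierMap p e R} {ψ : CartierMap p e S}
    (h : IsTransposition T φ ψ) (ht : TameOverCSpec T φ) :
    @Continuous _ _ ψ.czTopology φ.czTopology (comap (algebraMap R S)) := by
  refine @Continuous.mk _ _ ψ.czTopology φ.czTopology _ fun U hU => ?_
  obtain ⟨a, ha, hUa⟩ : ∃ a : Ideal R, φ.IsCompatible a ∧ Uᶜ = zeroLocus (a : Set R) := hU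
  change ∃ b : Ideal S, ψ.IsCompatible b ∧
    (comap (algebraMap R S) ⁻¹' U)ᶜ = zeroLocus (b : Set S)
  have hmin : ∀ P ∈ a.minimalPrimes, ∃ hP : P.IsPrime,
      transposeIdeal T.toAddMonoidHom P = (P.map (algebraMap R S)).radical := fun P hP =>
    ⟨hP.1.1, ht ⟨P, hP.1.1⟩ (ha.of_mem_minimalPrimes hq hP)⟩
  have hfin : a.minimalPrimes.Finite := Ideal.finite_minimalPrimes_of_isNoetherianRing R a
  -- V(a) is the finite union of the V(P) for P minimal over a, and tameness makes V(P^T) the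
  -- preimage of V(P).
  refine ⟨sInf (transposeIdeal T.toAddMonoidHom '' a.minimalPrimes), ?_, ?_⟩
  · refine CartierMap.IsCompatible.sInf ?_
    rintro _ ⟨P, hP, rfl⟩
    exact isCompatible_transposeIdeal h.comm (ha.of_mem_minimalPrimes hq hP)
  · rw [← Set.preimage_compl, hUa]
    ext Q
    rw [Set.mem_preimage, mem_zeroLocus, mem_zeroLocus, SetLike.coe_subset_coe,
      SetLike.coe_subset_coe]
    constructor
    · intro hQ
      obtain ⟨P, hP, hPQ⟩ := Ideal.exists_minimalPrimes_le hQ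
      refine (sInf_le (Set.mem_image_of_mem _ hP)).trans ?_
      rw [(hmin P hP).2, Q.2.radical_le_iff, Ideal.map_le_iff_le_comap]
      exact hPQ
    · intro hQ
      have hinf : hfin.toFinset.inf (transposeIdeal T.toAddMonoidHom) ≤ Q.asIdeal := by
        refine le_trans (le_sInf ?_) hQ
        rintro _ ⟨P, hP, rfl⟩
        exact Finset.inf_le (hfin.mem_toFinset.2 hP)
      obtain ⟨P, hP, hPQ⟩ := Q.2.inf_le'.1 hinf
      exact (hfin.mem_toFinset.1 hP).1.2.trans
        (Ideal.map_le_iff_le_comap.1 ((map_le_transposeIdeal T P).trans hPQ))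

end Transposition

/-! ### F-purity tested prime by prime -/

theorem CartierMap.mem_fPureLocus_of_exists_notMem {p e : ℕ} {A : Type u} [CommRing A]
    {φ : CartierMap p e A} {P : PrimeSpectrum A} (h : ∃ x, φ x ∉ P.asIdeal) :
    P ∈ φ.fPureLocus := by
  obtain ⟨x, hx⟩ := h
  intro htop
  have h1 : (1 : A) ∈ φ.cartierCore P.asIdeal := htop ▸ Submodule.mem_top
  rw [CartierMap.cartierCore, Ideal.mem_iInf] at h1
  have h2 := (Ideal.mem_iInf.1 (h1 1)) le_rfl x
  rw [one_mul] at h2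
  exact hx h2

theorem CartierMap.IsFPure.exists_notMem {p e : ℕ} {A : Type u} [CommRing A]
    {φ : CartierMap p e A} (h : φ.IsFPure) (P : PrimeSpectrum A) : ∃ x, φ x ∉ P.asIdeal := by
  by_contra! hP
  have h1 : P ∈ φ.fPureLocus := h ▸ Set.mem_univ P
  refine h1 (eq_top_iff.2 fun x _ => ?_)
  refine Ideal.mem_iInf.2 fun n => Ideal.mem_iInf.2 fun hn c => ?_
  obtain ⟨m, rfl⟩ := Nat.exists_eq_succ_of_ne_zero (by omega : n ≠ 0)
  exact hP _

/-! ### The implications between tameness, fiberedness and test ideals -/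

section Transposition

variable {p e : ℕ} {R : Type u} {S : Type v} [CommRing R] [CommRing S] [Algebra R S]
  {T : S →ₗ[R] R} {φ : CartierMap p e R} {ψ : CartierMap p e S}

namespace IsTransposition

theorem charP [Fact p.Prime] [CharP R p] (h : IsTransposition T φ ψ) : CharP S p := by
  have hp : p.Prime := Fact.out
  have := CharP.nontrivial_of_char_ne_one (R := R) hp.ne_one
  have : Nontrivial S := by
    by_contra hS
    rw [not_nontrivial_iff_subsingleton] at hS
    have h1 : (1 : R) ∈ nilradical R := h.ker_le (Subsingleton.elim _ _)
    exact not_isNilpotent_one h1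
  exact ringChar.of_eq (CharP.ringChar_of_prime_eq_zero hp
    (by rw [← map_natCast (algebraMap R S) p, CharP.cast_eq_zero, map_zero]))

theorem finite_iterateFrobenius [Fact p.Prime] [CharP R p] [CharP S p]
    (h : IsTransposition T φ ψ) (hF : (iterateFrobenius R p e).Finite) :
    (iterateFrobenius S p e).Finite := by
  refine RingHom.Finite.of_comp_finite (f := algebraMap R S) ?_
  rw [← RingHom.iterateFrobenius_comm]
  exact (RingHom.finite_algebraMap.2 h.finite).comp hF

theorem exists_induces_reducedFiber [IsNoetherianRing R] (hq : p ^ e ≠ 0)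
    (h : IsTransposition T φ ψ) {P : PrimeSpectrum R} (hP : P ∈ φ.CSpec)
    (ht : IsTamelyRamified T P) :
    ∃ ψbar : CartierMap p e (ReducedFiber S P), ψ.Induces (toReducedFiber S P) ψbar :=
  CartierMap.exists_induces hq ψ _ (fun x hx => by
    rw [toReducedFiber_eq_zero_iff] at hx ⊢
    exact fun Q hQ => h.mem_cSpec_of_isTamelyRamified hq hP ht hQ x (hx Q hQ))
    (toReducedFiber_exists_mul_eq P)

theorem isFibered_of_tameOverCSpec [IsNoetherianRing R] (hq : p ^ e ≠ 0)
    (h : IsTransposition T φ ψ) (ht : TameOverCSpec T φ) : IsFibered T φ ψ where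
  continuous := continuous_comap_of_tameOverCSpec hq h ht
  isRadical P hP := by
    rw [ht P hP]
    exact Ideal.radical_isRadical _
  fiber P hP := by
    obtain ⟨φbar, hφ⟩ := CartierMap.IsCompatible.exists_induces_residueField hq hP
    obtain ⟨ψbar, hψ⟩ := h.exists_induces_reducedFiber hq hP (ht P hP)
    refine ⟨φbar, ψbar, hφ, hψ, fun h0 => Set.eq_univ_of_forall fun q => ?_⟩
    have hQ := h.mem_schpec_of_isTamelyRamified hq ⟨hP, φbar, hφ, h0⟩ (ht P hP)
      (comap_toReducedFiber q)
    obtain ⟨x, hx⟩ := ((CartierMap.mem_schpec_iff hq).1 hQ).2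
    refine CartierMap.mem_fPureLocus_of_exists_notMem ⟨toReducedFiber S P x, ?_⟩
    rw [hψ x]
    exact hx
  fiber_zero P hP := by
    obtain ⟨φbar, hφ⟩ := CartierMap.IsCompatible.exists_induces_residueField hq hP
    obtain ⟨ψbar, hψ⟩ := h.exists_induces_reducedFiber hq hP (ht P hP)
    refine ⟨φbar, ψbar, hφ, hψ, fun h0 => ?_⟩
    have hφP : ∀ x, φ x ∈ P.asIdeal := by
      by_contra! hx
      exact (hφ.ne_zero_iff hq).2 hx h0
    refine hψ.eq_zero hq (toReducedFiber_exists_mul_eq P) fun s => ?_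
    -- All values of ψ lie in P^T, since T(c ψ(s)) = φ(T(c^q s)) ∈ P.
    refine toReducedFiber_eq_zero_iff.2 fun Q hQ => (ht P hP).transposeIdeal_le hQ ?_
    rw [mem_transposeIdeal]
    intro c
    rw [mul_comm, ← ψ.map_pow_mul, h.comm]
    exact hφP _

theorem fiberedWithTestIdeals_of_tameOverCSpec [Fact p.Prime] (he : 1 ≤ e) [CharP R p]
    [IsNoetherianRing R] (hF : (iterateFrobenius R p e).Finite) (h : IsTransposition T φ ψ)
    (ht : TameOverCSpec T φ) : FiberedWithTestIdeals T φ ψ := by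
  have hq : p ^ e ≠ 0 := pow_ne_zero _ (Fact.out : p.Prime).ne_zero
  have := h.charP
  have := h.isNoetherianRing
  refine ⟨h.isFibered_of_tameOverCSpec hq ht, fun P hP Q hQ => le_antisymm ?_ ?_⟩
  · refine le_sInf fun a ha => imageIdeal_le_iff.2 ?_
    rw [zeroDivisorsMod_of_isPrime] at ha
    refine CartierMap.testIdeal_le (isCompatible_transposeIdeal h.comm ha.1) fun hle => ha.2 ?_
    rw [← hQ]
    exact Ideal.map_le_iff_le_comap.1 ((map_le_transposeIdeal T a).trans hle)
  · refine CartierMap.testIdeal_le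
      (isCompatible_imageIdeal h.comm (CartierMap.isCompatible_testIdeal ψ _)) fun hle => ?_
    exact CartierMap.not_testIdeal_le he (h.finite_iterateFrobenius hF)
      (h.mem_schpec_of_isTamelyRamified hq hP (ht P hP.1) hQ)
      ((imageIdeal_le_iff.1 hle).trans ((ht P hP.1).transposeIdeal_le hQ))

theorem tameOverSchpec_of_fiberedWithTestIdeals [Fact p.Prime] (he : 1 ≤ e) [CharP R p]
    [IsNoetherianRing R] (hF : (iterateFrobenius R p e).Finite) (h : IsTransposition T φ ψ)
    (hmin : MinimalPrimesLieOver S φ) (hf : FiberedWithTestIdeals T φ ψ) :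
    TameOverSchpec T φ := by
  have := h.isNoetherianRing
  intro P hP
  refine le_antisymm ?_
    ((hf.1.isRadical P hP.1).radical_le_iff.2 (map_le_transposeIdeal T _))
  rw [← Ideal.sInf_minimalPrimes]
  refine le_sInf fun Q hQ => ?_
  have hQ' := hQ.1.1
  by_contra hle
  refine CartierMap.not_testIdeal_le he hF hP ?_
  -- The condition on minimal primes is what places Q over P, where the test ideal equality is
  -- available.
  rw [← hf.2 P hP ⟨Q, hQ'⟩ (PrimeSpectrum.ext (hmin P hP Q hQ)), imageIdeal_le_iff]
  exact CartierMap.testIdeal_le (isCompatible_transposeIdeal h.comm hP.1) hle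

end IsTransposition

theorem tameOverCSpec_iff_of_isFPure (hq : p ^ e ≠ 0) (h : φ.IsFPure) :
    TameOverCSpec T φ ↔ TameOverSchpec T φ :=
  ⟨fun ht P hP => ht P hP.1, fun ht P hP =>
    ht P ((CartierMap.mem_schpec_iff hq).2 ⟨hP, h.exists_notMem P⟩)⟩

end Transposition

end TameCartier

open TameCartier in
theorem mainTheorem1 {p e : ℕ} [Fact p.Prime] (he : 1 ≤ e)
    {R : Type*} {S : Type*} [CommRing R] [CommRing S] [Algebra R S]
    [CharP R p] [IsNoetherianRing R] (hF : (frobenius R p).Finite)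
    (T : S →ₗ[R] R) (φ : CartierMap p e R) (ψ : CartierMap p e S)
    (h : IsTransposition T φ ψ) :
    (TameOverCSpec T φ → FiberedWithTestIdeals T φ ψ) ∧
    (MinimalPrimesLieOver S φ → FiberedWithTestIdeals T φ ψ → TameOverSchpec T φ) ∧
    (φ.IsFPure →
      (TameOverCSpec T φ ↔ TameOverSchpec T φ) ∧
      (MinimalPrimesLieOver S φ →
        [TameOverCSpec T φ, FiberedWithTestIdeals T φ ψ, TameOverSchpec T φ].TFAE)) := by
  have hq : p ^ e ≠ 0 := pow_ne_zero _ (Fact.out : p.Prime).ne_zero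
  have hFe : ∀ n, (iterateFrobenius R p n).Finite := fun n => by
    induction n with
    | zero => exact iterateFrobenius_zero R p ▸ RingHom.Finite.id R
    | succ n ih =>
      rw [iterateFrobenius_add, iterateFrobenius_one]
      exact ih.comp hF
  have hab := h.fiberedWithTestIdeals_of_tameOverCSpec he (hFe e)
  have hbc := h.tameOverSchpec_of_fiberedWithTestIdeals he (hFe e)
  refine ⟨hab, hbc, fun hpure => ⟨tameOverCSpec_iff_of_isFPure hq hpure, fun hmin => ?_⟩⟩
  tfae_have 1 → 2 := hab
  tfae_have 2 → 3 := hbc hmin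
  tfae_have 3 → 1 := (tameOverCSpec_iff_of_isFPure hq hpure).2
  tfae_finish
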